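/- Let $E_1,E_2$ be finite-dimensional real inner product spaces. For $f:E\to\overline{\mathbb R}$ on such a space put $\operatorname{dom} f=\{x: f(x)<+\infty\}$ and $f^*(y)=\sup_x\{\langle y,x\rangle-f(x)\}$, and let $\operatorname{cl} f$ be its lower semicontinuous hull, $(\operatorname{cl} f)(x)=\inf\{\alpha\in\overline{\mathbb R}:\exists\, x_k\to x,\ f(x_k)\to\alpha\}$. The function $f$ is convex if its epigraph $\{(x,\alpha)\in E\times\mathbb R: f(x)\le\alpha\}$ is convex, proper if $\operatorname{dom} f\ne\emptyset$ and $f$ never takes the value $-\infty$, and closed if it is lower semicontinuous. Let $\Gamma(E)$ be the set of proper convex functions on $E$, and $\Gamma_0(E)$ the set of closed functions in $\Gamma(E)$. Let $\operatorname{ri}$ denote relative interior. Let $K\subset E_2$ be a nonempty closed convex cone, $K^\circ=\{v:\langle v,x\rangle\le 0\ \forall x\in K\}$ its polar cone, and write $x\le_K y$ iff $y-x\in K$. Let $F:E_1\to E_2\cup\{+\infty_\bullet\}$, where $+\infty_\bullet$ is a largest element adjoined to $E_2$. Put $\operatorname{dom}F=\{x:F(x)\in E_2\}$, assumed nonempty,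 and $\operatorname{rge}F=F(\operatorname{dom}F)$. Suppose that $F$ is $K$-convex, i.e. its $K$-epigraph $\{(x,v)\in E_1\times E_2: x\in\operatorname{dom}F,\ F(x)\le_K v\}$ is convex. For $g:E_2\to\mathbb R\cup\{+\infty\}$ let $(g\circ F)(x)=g(F(x))$ if $x\in\operatorname{dom}F$ and $+\infty$ otherwise; for $v\in E_2$ let $\langle v,F\rangle(x)=\langle v,F(x)\rangle$ if $x\in\operatorname{dom}F$ and $+\infty$ otherwise. Suppose that $g\in\Gamma(E_2)$ and that $$g(F(x))\le g(y)\quad\text{whenever } x\in \operatorname{dom}F,\ y\in E_2,\ F(x)\le_K y .$$ Define $\eta(p)=\inf_{v\in -K^\circ}\{g^*(v)+\langle v,F\rangle^*(p)\}$ for $p\in E_1$. Then: a) $(g\circ F)^*\le\operatorname{cl}\eta$. Equality holds if, in addition, $\langle v,F\rangle\in\Gamma_0(E_1)$ for all $v\in-K^\circ$, $g$ is lower semicontinuous and $K$-increasing (i.e. $u\le_K v$ implies $g(u)\le g(v)$), and $\operatorname{rge}F\cap\operatorname{dom}g\ne\emptyset$. b) If $F(\operatorname{ri}(\operatorname{dom}F))\cap\operatorname{ri}(\operatorname{dom}g-K)\neq\emptyset$,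 then $\eta$ is closed, proper and convex, and for every $p\in E_1$ the infimum defining $\eta(p)$ is attained (the value may be $+\infty$). c) Under the assumptions of b), for every $p\in E_1$, $$(g\circ F)^*(p)=\min_{v\in-K^\circ}\{g^*(v)+\langle v,F\rangle^*(p)\},$$ the minimum being attained, and $\operatorname{dom}(g\circ F)^*=\{p\in E_1:\exists\, v\in\operatorname{dom}g^*\cap(-K^\circ),\ \langle v,F\rangle^*(p)<+\infty\}$. -/

import Mathlib

open scoped Pointwise
open Filter Topology

noncomputable section

namespace ConvexComposite

section Functions

variable {E : Type*} [NormedAddCommGroup E] [InnerProductSpace ℝ E]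

/-- Epigraph `{(x, α) ∈ E × ℝ | f x ≤ α}` of an extended-real-valued function. -/
def epi (f : E → EReal) : Set (E × ℝ) := {q | f q.1 ≤ (q.2 : EReal)}

/-- Effective domain `{x | f x < +∞}`. -/
def dom (f : E → EReal) : Set E := {x | f x < ⊤}

/-- `f` is convex: its epigraph is a convex set. -/
def IsConvexFun (f : E → EReal) : Prop := Convex ℝ (epi f)

/-- `f` is proper: its domain is nonempty and it never takes the value `-∞`. -/
def IsProperFun (f : E → EReal) : Prop := (dom f).Nonempty ∧ ∀ x, f x ≠ ⊥

/-- The class `Γ(E)` of proper convex functions. -/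
def Gam (E : Type*) [NormedAddCommGroup E] [InnerProductSpace ℝ E] : Set (E → EReal) :=
  {f | IsProperFun f ∧ IsConvexFun f}

/-- The class `Γ₀(E)` of lower semicontinuous proper convex functions. -/
def Gam0 (E : Type*) [NormedAddCommGroup E] [InnerProductSpace ℝ E] : Set (E → EReal) :=
  {f | f ∈ Gam E ∧ LowerSemicontinuous f}

/-- Lower semicontinuous hull:
`(cl f)(x) = inf {α | there are x_k → x with f (x_k) → α}`. -/
def cl (f : E → EReal) : E → EReal := fun x =>
  sInf {α : EReal | ∃ u : ℕ → E, Tendsto u atTop (𝓝 x) ∧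
    Tendsto (fun k => f (u k)) atTop (𝓝 α)}

/-- Fenchel conjugate `f*(y) = sup_x (⟨y, x⟩ - f x)`. -/
def conj (f : E → EReal) : E → EReal := fun y =>
  ⨆ x : E, (((inner ℝ y x : ℝ) : EReal) - f x)

/-- Polar cone `K° = {v | ⟨v, x⟩ ≤ 0 for all x ∈ K}`. -/
def polar (K : Set E) : Set E := {v | ∀ x ∈ K, inner ℝ v x ≤ 0}

/-- The ordering `x ≤_K y` induced by `K` on `E ∪ {+∞}`: it means `y - x ∈ K` for points of `E`,
every element is below `+∞`, and `+∞` is not below a point of `E`. -/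
def coneLE (K : Set E) (x y : WithTop E) : Prop :=
  ∀ b : E, y = (b : WithTop E) → ∃ a : E, x = (a : WithTop E) ∧ b - a ∈ K

/-- `g` is `K`-increasing: `u ≤_K v` implies `g u ≤ g v`. -/
def IsIncreasing (K : Set E) (g : E → EReal) : Prop :=
  ∀ u v : E, coneLE K (u : WithTop E) (v : WithTop E) → g u ≤ g v

end Functions

section Maps

variable {E₁ E₂ : Type*} [NormedAddCommGroup E₁] [InnerProductSpace ℝ E₁]
  [NormedAddCommGroup E₂] [InnerProductSpace ℝ E₂]

/-- Domain of `F : E₁ → E₂ ∪ {+∞}`: the points where `F` takes its value in `E₂`. -/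
def domMap (F : E₁ → WithTop E₂) : Set E₁ := {x | F x ≠ ⊤}

/-- Range of `F : E₁ → E₂ ∪ {+∞}`: its values in `E₂`. -/
def rge (F : E₁ → WithTop E₂) : Set E₂ := {y | ∃ x, F x = (y : WithTop E₂)}

/-- `K`-epigraph `{(x, v) ∈ E₁ × E₂ | F x ≤_K v}`. -/
def coneEpi (K : Set E₂) (F : E₁ → WithTop E₂) : Set (E₁ × E₂) :=
  {q | coneLE K (F q.1) (q.2 : WithTop E₂)}

/-- `F` is `K`-convex: its `K`-epigraph is convex. -/
def IsConeConvex (K : Set E₂) (F : E₁ → WithTop E₂) : Prop := Convex ℝ (coneEpi K F)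

/-- Composition `g ∘ F`, equal to `g (F x)` on the domain of `F` and `+∞` elsewhere. -/
def comp (g : E₂ → EReal) (F : E₁ → WithTop E₂) : E₁ → EReal := fun x =>
  WithTop.recTopCoe (C := fun _ => EReal) ⊤ g (F x)

/-- Scalarization `⟨v, F⟩ = ⟨v, ·⟩ ∘ F`. -/
def scal (v : E₂) (F : E₁ → WithTop E₂) : E₁ → EReal :=
  comp (fun y => ((inner ℝ v y : ℝ) : EReal)) F

/-- `η(p) = inf_{v ∈ -K°} g*(v) + ⟨v, F⟩*(p)`. -/
def eta (K : Set E₂) (g : E₂ → EReal) (F : E₁ → WithTop E₂) : E₁ → EReal := fun p =>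
  ⨅ v ∈ -polar K, (conj g v + conj (scal v F) p)

end Maps

end ConvexComposite

end

/-! Adding the Fenchel–Young inequalities for `g` and for `⟨v, F⟩` gives `(g ∘ F)* ≤ g*(v) + ⟨v,
F⟩*` for every `v`, hence `(g ∘ F)* ≤ η`. Conjugates are lower semicontinuous, so the bound passes
to `cl η`.

For equality in a), biconjugation of `g` and then of `⟨v, F⟩` gives `g ∘ F ≤ η*`; monotonicity of
`g` forces the relevant `v` into `-K°`. Conjugating once more and applying Fenchel–Moreau
(`cl_le_conj_conj`) to the proper convex function `η` yields `cl η ≤ η** ≤ (g ∘ F)*`.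

For b) and c), fix `p` and a real `μ ≥ (g ∘ F)*(p)`. The pairs `(y - d, a - ⟨p, x⟩ + μ)`, with `(x,
y)` in the `K`-epigraph and `g d ≤ a`, form a convex set whose heights over `0` are nonnegative. The
constraint qualification makes `0` a relative algebraic interior point of its projection
(`exists_neg_smul_sub_eq`), so the set lies above a linear graph (`exists_linear_le`). The negated
slope is an optimal `v`. Thus `η = (g ∘ F)*` with attainment, and `η` inherits the properties of a
conjugate. -/

namespace ConvexComposite

/-! ### Linear minorants of convex sets in `V × ℝ`. -/

section Separation

variable {V : Type*} [AddCommGroup V] [Module ℝ V]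

/-- The pointed cone of nonnegative multiples of the points of a nonempty convex set. -/
def coneOf (S : Set V) (hS : Convex ℝ S) (hne : S.Nonempty) : PointedCone ℝ V where
  carrier := {x | ∃ c : ℝ, 0 ≤ c ∧ ∃ y ∈ S, c • y = x}
  zero_mem' := ⟨0, le_rfl, hne.some, hne.some_mem, zero_smul _ _⟩
  add_mem' := by
    rintro _ _ ⟨c, hc, y, hy, rfl⟩ ⟨d, hd, z, hz, rfl⟩
    rcases (add_nonneg hc hd).eq_or_lt with h | h
    · have hc0 : c = 0 := by linarith
      have hd0 : d = 0 := by linarith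
      exact ⟨0, le_rfl, y, hy, by simp [hc0, hd0]⟩
    · refine ⟨c + d, h.le, _, hS hy hz (div_nonneg hc h.le) (div_nonneg hd h.le)
        (by rw [← add_div, div_self h.ne']), ?_⟩
      rw [smul_add, smul_smul, smul_smul, mul_div_cancel₀ _ h.ne', mul_div_cancel₀ _ h.ne']
  smul_mem' := by
    rintro ⟨a, ha⟩ _ ⟨c, hc, y, hy, rfl⟩
    exact ⟨a * c, mul_nonneg ha hc, y, hy, mul_smul a c y⟩

theorem mem_coneOf {S : Set V} {hS : Convex ℝ S} {hne : S.Nonempty} {x : V} :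
    x ∈ coneOf S hS hne ↔ ∃ c : ℝ, 0 ≤ c ∧ ∃ y ∈ S, c • y = x := Iff.rfl

/-- A convex set in `V × ℝ` with absorbing projection and nonnegative heights over `0` lies above
the graph of a linear functional. -/
theorem exists_linear_le_of_absorbing {S : Set (V × ℝ)} (hS : Convex ℝ S)
    (h0 : ∀ r : ℝ, (0, r) ∈ S → 0 ≤ r)
    (habs : ∀ u : V, ∃ c : ℝ, 0 < c ∧ ∃ r : ℝ, (c • u, r) ∈ S) :
    ∃ l : V →ₗ[ℝ] ℝ, ∀ q ∈ S, l q.1 ≤ q.2 := by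
  have hne : S.Nonempty := by
    obtain ⟨c, -, r, h⟩ := habs 0
    exact ⟨_, h⟩
  let D : Submodule ℝ (V × ℝ) := Submodule.prod ⊥ ⊤
  let f : (V × ℝ) →ₗ.[ℝ] ℝ := ⟨D, (LinearMap.snd ℝ V ℝ).comp D.subtype⟩
  obtain ⟨G, hG, hGS⟩ := riesz_extension (coneOf S hS hne) f
    (by
      rintro ⟨⟨u, r⟩, hu⟩ hx
      obtain rfl : u = 0 := by simpa [f, D] using hu
      obtain ⟨c, hc, ⟨y, s⟩, hy, hcy⟩ := mem_coneOf.1 hx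
      simp only [Prod.smul_mk, Prod.mk.injEq, smul_eq_mul] at hcy
      change 0 ≤ r
      rw [← hcy.2]
      rcases hc.eq_or_lt with rfl | hc
      · simp
      · obtain rfl : y = 0 := (smul_eq_zero.1 hcy.1).resolve_left hc.ne'
        exact mul_nonneg hc.le (h0 _ hy))
    -- Cofinality condition of the Riesz extension theorem: absorption lets every `(u, r)` be moved
    -- vertically into the cone.
    (by
      rintro ⟨u, r⟩
      obtain ⟨c, hc, s, h⟩ := habs u
      refine ⟨⟨(0, c⁻¹ * s - r), by simp [f, D]⟩, mem_coneOf.2 ⟨c⁻¹, (inv_pos.2 hc).le, _, h, ?_⟩⟩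
      simp [smul_smul, inv_mul_cancel₀ hc.ne'])
  refine ⟨-(G.comp (LinearMap.inl ℝ V ℝ)), fun q hq => ?_⟩
  have h1 : 0 ≤ G q := hGS q (mem_coneOf.2 ⟨1, zero_le_one, q, hq, one_smul _ _⟩)
  have h2 : G (0, q.2) = q.2 := hG ⟨(0, q.2), by simp [f, D]⟩
  have h3 : G q = G (q.1, 0) + G (0, q.2) := by
    rw [← map_add]; simp
  simp only [LinearMap.neg_apply, LinearMap.comp_apply, LinearMap.inl_apply]
  linarith

/-- A convex set in `V × ℝ` with nonnegative heights over `0`, whose projection has `0` as a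
relative algebraic interior point, lies above the graph of a linear functional. -/
theorem exists_linear_le {S : Set (V × ℝ)} (hS : Convex ℝ S) (hne : S.Nonempty)
    (h0 : ∀ r : ℝ, (0, r) ∈ S → 0 ≤ r)
    (hext : ∀ q ∈ S, ∃ c : ℝ, 0 < c ∧ ∃ r : ℝ, (-(c • q.1), r) ∈ S) :
    ∃ l : V →ₗ[ℝ] ℝ, ∀ q ∈ S, l q.1 ≤ q.2 := by
  let A : Set V := Prod.fst '' S
  let L : Submodule ℝ V := Submodule.span ℝ A
  -- The weights `b / (a + b)` and `a / (a + b)` give `u` and `v` the same coefficient `a * b / (a +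
  -- b)`.
  have hcomb : ∀ u v : V, ∀ a b : ℝ, 0 < a → 0 < b → (∃ r : ℝ, (a • u, r) ∈ S) →
      (∃ r : ℝ, (b • v, r) ∈ S) → ∃ c : ℝ, 0 < c ∧ ∃ r : ℝ, (c • (u + v), r) ∈ S := by
    rintro u v a b ha hb ⟨r, hr⟩ ⟨s, hs⟩
    have hab : 0 < a + b := add_pos ha hb
    have := hS hr hs (div_nonneg hb.le hab.le) (div_nonneg ha.le hab.le)
      (by rw [← add_div, add_comm, div_self hab.ne'])
    refine ⟨a * b / (a + b), by positivity, b / (a + b) * r + a / (a + b) * s, ?_⟩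
    convert this using 1
    simp only [Prod.smul_mk, Prod.mk_add_mk, smul_eq_mul, smul_smul, smul_add]
    congr 3 <;> ring
  have hneg : ∀ u : V, (∃ c : ℝ, 0 < c ∧ ∃ r : ℝ, (c • u, r) ∈ S) →
      ∃ c : ℝ, 0 < c ∧ ∃ r : ℝ, (c • (-u), r) ∈ S := by
    rintro u ⟨c, hc, r, h⟩
    obtain ⟨d, hd, s, hs⟩ := hext _ h
    exact ⟨d * c, mul_pos hd hc, s, by simpa [mul_smul] using hs⟩
  have hzero : ∃ c : ℝ, 0 < c ∧ ∃ r : ℝ, (c • (0 : V), r) ∈ S := by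
    obtain ⟨⟨u, r⟩, hu⟩ := hne
    obtain ⟨c, hc, s, hs⟩ := hneg u ⟨1, one_pos, r, by simpa using hu⟩
    simpa using hcomb u (-u) 1 c one_pos hc ⟨r, by simpa using hu⟩ ⟨s, hs⟩
  -- Within its linear span the projection is absorbing, so the previous lemma applies on `L`.
  have hL : ∀ u ∈ L, ∃ c : ℝ, 0 < c ∧ ∃ r : ℝ, (c • u, r) ∈ S := by
    intro u hu
    induction hu using Submodule.span_induction with
    | mem x hx =>
      obtain ⟨⟨x, r⟩, h, rfl⟩ := hx
      exact ⟨1, one_pos, r, by simpa using h⟩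
    | zero => exact hzero
    | add x y _ _ hx hy =>
      obtain ⟨a, ha, hx⟩ := hx
      obtain ⟨b, hb, hy⟩ := hy
      exact hcomb x y a b ha hb hx hy
    | smul t x _ hx =>
      have key : ∀ (t : ℝ) (x : V), 0 < t → (∃ c : ℝ, 0 < c ∧ ∃ r : ℝ, (c • x, r) ∈ S) →
          ∃ c : ℝ, 0 < c ∧ ∃ r : ℝ, (c • t • x, r) ∈ S := by
        rintro t x ht ⟨c, hc, r, h⟩
        exact ⟨c / t, div_pos hc ht, r, by rwa [smul_smul, div_mul_cancel₀ _ ht.ne']⟩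
      rcases lt_trichotomy t 0 with ht | rfl | ht
      · simpa using key (-t) (-x) (neg_pos.2 ht) (hneg x hx)
      · simpa using hzero
      · exact key t x ht hx
  obtain ⟨l, hl⟩ := exists_linear_le_of_absorbing (V := L)
    (S := (L.subtype.prodMap LinearMap.id) ⁻¹' S) (hS.linear_preimage _)
    (fun r hr => h0 r (by simpa using hr))
    (fun u => by
      obtain ⟨c, hc, r, h⟩ := hL u u.2
      exact ⟨c, hc, r, by simpa using h⟩)
  obtain ⟨m, hm⟩ := l.exists_extend
  refine ⟨m, fun q hq => ?_⟩
  have hq1 : q.1 ∈ L := Submodule.subset_span ⟨q, hq, rfl⟩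
  have := hl (⟨q.1, hq1⟩, q.2) (by simpa using hq)
  rw [← hm] at this
  simpa using this

end Separation

/-! ### Relative interior points. -/

section RelInt

variable {V : Type*} [NormedAddCommGroup V] [NormedSpace ℝ V]

/-- Segments ending at a relative interior point can be prolonged inside the set. -/
theorem exists_prolong_of_mem_intrinsicInterior {S : Set V} {x y : V}
    (hx : x ∈ intrinsicInterior ℝ S) (hy : y ∈ S) : ∃ c : ℝ, 0 < c ∧ x - c • (y - x) ∈ S := by
  obtain ⟨z, hz, rfl⟩ := mem_intrinsicInterior.1 hx
  let γ : ℝ → affineSpan ℝ S := fun t =>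
    ⟨AffineMap.lineMap (z : V) y t,
      AffineMap.lineMap_mem t z.2 (subset_affineSpan ℝ S hy)⟩
  have hγ : Continuous γ := by
    refine Continuous.subtype_mk ?_ _
    exact AffineMap.lineMap_continuous
  have h0 : γ 0 = z := Subtype.ext (by simp [γ])
  have hev : ∀ᶠ t in 𝓝 (0 : ℝ), (γ t : V) ∈ S := by
    refine (hγ.tendsto 0).eventually (p := fun w : affineSpan ℝ S => (w : V) ∈ S) ?_
    rw [h0]
    exact mem_interior_iff_mem_nhds.1 hz
  obtain ⟨ε, hε, h⟩ := Metric.eventually_nhds_iff.1 hev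
  refine ⟨ε / 2, half_pos hε, ?_⟩
  have := h (y := -(ε / 2)) (by
    rw [Real.dist_eq, sub_zero, abs_neg, abs_of_pos (half_pos hε)]
    exact half_lt_self hε)
  convert this using 1
  simp only [γ, AffineMap.lineMap_apply, vsub_eq_sub, vadd_eq_add]
  module

end RelInt

/-! ### Lower semicontinuous hulls. -/

section Hull

variable {E : Type*} [NormedAddCommGroup E]

theorem le_cl_of_le {f h : E → EReal} (hh : LowerSemicontinuous h) (hle : ∀ x, h x ≤ f x) (x : E) :
    h x ≤ cl f x := by
  refine le_sInf ?_
  rintro α ⟨u, hu, hα⟩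
  refine le_of_forall_lt fun c hc => ?_
  obtain ⟨d, hcd, hd⟩ := exists_between hc
  refine hcd.trans_le (ge_of_tendsto hα ?_)
  filter_upwards [hu.eventually (hh x d hd)] with k hk
  exact hk.le.trans (hle _)

/-- `EReal` is compact, so along a subsequence the values of `f` converge, to a limit at most `r`.
-/
theorem cl_le_of_mem_closure_epi {f : E → EReal} {x : E} {r : ℝ} (h : (x, r) ∈ closure (epi f)) :
    cl f x ≤ r := by
  obtain ⟨q, hq, hlim⟩ := mem_closure_iff_seq_limit.1 h
  obtain ⟨α, φ, hφ, hα⟩ := CompactSpace.tendsto_subseq fun n => f (q n).1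
  have h1 : Tendsto (fun n => (q n).1) atTop (𝓝 x) := (continuous_fst.tendsto _).comp hlim
  have h2 : Tendsto (fun n => (((q n).2 : ℝ) : EReal)) atTop (𝓝 (r : EReal)) :=
    ((continuous_coe_real_ereal.comp continuous_snd).tendsto (x, r)).comp hlim
  have h3 : cl f x ≤ α := sInf_le ⟨fun k => (q (φ k)).1, h1.comp hφ.tendsto_atTop, hα⟩
  exact h3.trans (le_of_tendsto_of_tendsto' hα (h2.comp hφ.tendsto_atTop) fun n => hq _)

end Hull

/-! ### Conjugates and Fenchel–Moreau. -/

section Functions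

variable {E : Type*} [NormedAddCommGroup E] [InnerProductSpace ℝ E]

/-- Real upper bounds `a` stand in for `f x`, which keeps later arguments in `ℝ`: the value `⊥`
admits every `a`, the value `⊤` none. -/
theorem conj_le_coe_iff {f : E → EReal} {y : E} {c : ℝ} :
    conj f y ≤ c ↔ ∀ (x : E) (a : ℝ), f x ≤ a → inner ℝ y x - c ≤ a := by
  unfold conj
  rw [iSup_le_iff]
  refine forall_congr' fun x => ?_
  constructor
  · intro h a ha
    have h1 : ((inner ℝ y x : ℝ) : EReal) - a ≤ c := (EReal.sub_le_sub le_rfl ha).trans h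
    rw [← EReal.coe_sub, EReal.coe_le_coe_iff] at h1
    linarith
  · intro h
    induction hfx : f x using EReal.rec with
    | bot =>
      have := h (inner ℝ y x - c - 1) (by simp [hfx])
      linarith
    | top => simp
    | coe r =>
      have := h r hfx.le
      rw [← EReal.coe_sub, EReal.coe_le_coe_iff]
      linarith

theorem coe_sub_le_conj {f : E → EReal} {x y : E} {a : ℝ} (h : f x ≤ a) :
    ((inner ℝ y x - a : ℝ) : EReal) ≤ conj f y := by
  rw [EReal.coe_sub]
  exact (EReal.sub_le_sub le_rfl h).trans
    (le_iSup (fun x => ((inner ℝ y x : ℝ) : EReal) - f x) x)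

theorem exists_le_coe {a : EReal} (h : a < ⊤) : ∃ r : ℝ, a ≤ r := by
  obtain ⟨r, hr, -⟩ := EReal.lt_iff_exists_real_btwn.1 h
  exact ⟨r, hr.le⟩

theorem conj_ne_bot {f : E → EReal} (h : (dom f).Nonempty) (y : E) : conj f y ≠ ⊥ := by
  obtain ⟨x, hx⟩ := h
  obtain ⟨r, hr⟩ := exists_le_coe hx
  exact ne_bot_of_le_ne_bot (EReal.coe_ne_bot _) (coe_sub_le_conj (y := y) hr)

theorem exists_coe_eq_conj {f : E → EReal} (h : (dom f).Nonempty) {y : E} (hy : conj f y < ⊤) :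
    ∃ r : ℝ, conj f y = r :=
  ⟨_, (EReal.coe_toReal hy.ne (conj_ne_bot h y)).symm⟩

theorem lowerSemicontinuous_conj (f : E → EReal) : LowerSemicontinuous (conj f) := by
  refine lowerSemicontinuous_iSup fun x => Continuous.lowerSemicontinuous ?_
  induction f x using EReal.rec with
  | bot => simpa using continuous_const
  | top => simpa using continuous_const
  | coe r =>
    simp only [← EReal.coe_sub]
    exact continuous_coe_real_ereal.comp (by fun_prop)

theorem isConvexFun_conj (f : E → EReal) : IsConvexFun (conj f) := by
  rintro ⟨y, c⟩ hy ⟨z, d⟩ hz a b ha hb hab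
  simp only [epi, Set.mem_ofPred_eq] at hy hz ⊢
  rw [conj_le_coe_iff] at hy hz
  refine conj_le_coe_iff.2 fun x r hr => ?_
  have h1 := mul_le_mul_of_nonneg_left (hy x r hr) ha
  have h2 := mul_le_mul_of_nonneg_left (hz x r hr) hb
  have h3 : a * r + b * r = r := by rw [← add_mul, hab, one_mul]
  simp only [Prod.smul_mk, Prod.mk_add_mk, smul_eq_mul, inner_add_left, real_inner_smul_left]
  linarith

theorem convex_dom {f : E → EReal} (hf : IsConvexFun f) : Convex ℝ (dom f) := by
  have : dom f = LinearMap.fst ℝ E ℝ '' epi f := by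
    ext x
    constructor
    · intro hx
      obtain ⟨r, hr⟩ := exists_le_coe hx
      exact ⟨(x, r), hr, rfl⟩
    · rintro ⟨⟨x, r⟩, h, rfl⟩
      exact lt_of_le_of_lt h (EReal.coe_lt_top r)
  rw [this]
  exact hf.linear_image _

theorem conj_antitone {f h : E → EReal} (hle : ∀ x, f x ≤ h x) (y : E) : conj h y ≤ conj f y :=
  iSup_mono fun x => EReal.sub_le_sub le_rfl (hle x)

variable [FiniteDimensional ℝ E]

theorem exists_inner_eq (l : E →ₗ[ℝ] ℝ) : ∃ v : E, ∀ x, l x = inner ℝ v x :=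
  ⟨(InnerProductSpace.toDual ℝ E).symm (LinearMap.toContinuousLinearMap l), fun x => by simp⟩

/-- A proper convex function on a finite-dimensional space has an affine minorant. -/
theorem exists_conj_le {f : E → EReal} (hf : f ∈ Gam E) : ∃ (y : E) (c : ℝ), conj f y ≤ c := by
  obtain ⟨⟨hne, hbot⟩, hconv⟩ := hf
  have hdom : Convex ℝ (dom f) := convex_dom hconv
  obtain ⟨x₀, hx₀⟩ := hne.intrinsicInterior hdom
  have hx₀' : x₀ ∈ dom f := intrinsicInterior_subset hx₀
  obtain ⟨m, hm⟩ : ∃ m : ℝ, f x₀ = m := ⟨_, (EReal.coe_toReal hx₀'.ne (hbot _)).symm⟩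
  -- The epigraph is translated to put `(x₀, f x₀)` at the origin; relative interiority of `x₀`
  -- supplies the prolongations.
  obtain ⟨l, hl⟩ := exists_linear_le (S := (fun q => (x₀, m) + q) ⁻¹' epi f)
    (hconv.translate_preimage_right _) ⟨0, by simp [epi, hm]⟩
    (fun r hr => by
      simp only [Set.mem_preimage, epi, Set.mem_ofPred_eq, Prod.mk_add_mk, add_zero, hm,
        EReal.coe_le_coe_iff] at hr
      linarith)
    (by
      rintro ⟨u, r⟩ hu
      simp only [Set.mem_preimage, epi, Set.mem_ofPred_eq, Prod.mk_add_mk] at hu ⊢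
      obtain ⟨c, hc, h⟩ := exists_prolong_of_mem_intrinsicInterior hx₀
        (show x₀ + u ∈ dom f from lt_of_le_of_lt hu (EReal.coe_lt_top _))
      obtain ⟨s, hs⟩ := exists_le_coe (show f _ < ⊤ from h)
      refine ⟨c, hc, s - m, ?_⟩
      convert hs using 2
      · module
      · ring_nf)
  obtain ⟨y, hy⟩ := exists_inner_eq l
  refine ⟨y, inner ℝ y x₀ - m, conj_le_coe_iff.2 fun x a ha => ?_⟩
  have := hl (x - x₀, a - m) (by
    change f (x₀ + (x - x₀)) ≤ ((m + (a - m) : ℝ) : EReal)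
    rwa [add_sub_cancel, add_sub_cancel])
  simp only [hy, inner_sub_right] at this
  linarith

theorem isProperFun_conj {f : E → EReal} (hf : f ∈ Gam E) : IsProperFun (conj f) := by
  obtain ⟨y, c, h⟩ := exists_conj_le hf
  exact ⟨⟨y, h.trans_lt (EReal.coe_lt_top c)⟩, conj_ne_bot hf.1.1⟩

/-- The nontrivial half of the Fenchel–Moreau theorem. -/
theorem cl_le_conj_conj {f : E → EReal} (hf : f ∈ Gam E) (x : E) : cl f x ≤ conj (conj f) x := by
  refine EReal.ge_of_forall_gt_iff_ge.1 fun r hr => ?_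
  have hx : (x, r) ∉ closure (epi f) := fun h => (cl_le_of_mem_closure_epi h).not_gt hr
  obtain ⟨ψ, u, hψ, hu⟩ := geometric_hahn_banach_point_closed
    (Convex.closure (s := epi f) hf.2) isClosed_closure hx
  replace hu : ∀ q ∈ epi f, u < ψ q := fun q hq => hu q (subset_closure hq)
  obtain ⟨w, hw⟩ := exists_inner_eq (ψ.toLinearMap.comp (LinearMap.inl ℝ E ℝ))
  set s : ℝ := ψ (0, 1) with hs
  have hdec : ∀ (z : E) (a : ℝ), ψ (z, a) = inner ℝ w z + s * a := by
    intro z a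
    have h1 : ((z, a) : E × ℝ) = (z, 0) + a • ((0 : E), (1 : ℝ)) := by simp
    rw [h1, map_add, map_smul, ← hw z, smul_eq_mul, mul_comm]
    rfl
  have hu' : ∀ (z : E) (a : ℝ), f z ≤ a → u < inner ℝ w z + s * a := fun z a h => by
    rw [← hdec]; exact hu _ h
  rw [hdec] at hψ
  obtain ⟨y₀, c₀, h₀⟩ := exists_conj_le hf
  have h₀' := conj_le_coe_iff.1 h₀
  obtain ⟨x₁, hx₁⟩ := hf.1.1
  obtain ⟨a₁, ha₁⟩ := exists_le_coe hx₁
  -- If `s < 0`, climbing from `a₁` by the displayed amount brings the separating functional down to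
  -- exactly `u`.
  have hs0 : 0 ≤ s := by
    by_contra! hneg
    have h1 := hu' x₁ a₁ ha₁
    have h2 := hu' x₁ (a₁ + (inner ℝ w x₁ + s * a₁ - u) / (-s)) (ha₁.trans (by
      rw [EReal.coe_le_coe_iff]
      have : 0 ≤ (inner ℝ w x₁ + s * a₁ - u) / (-s) := div_nonneg (by linarith) (by linarith)
      linarith))
    have h3 : s * ((inner ℝ w x₁ + s * a₁ - u) / (-s)) = -(inner ℝ w x₁ + s * a₁ - u) := by
      rw [div_neg, mul_neg, mul_div_cancel₀ _ hneg.ne]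
    rw [mul_add, h3] at h2
    linarith
  -- an affine minorant exceeding `r` at `x`
  suffices h : ∃ (y : E) (c : ℝ), (∀ z a, f z ≤ (a : ℝ) → inner ℝ y z - c ≤ a) ∧
      r ≤ inner ℝ y x - c by
    obtain ⟨y, c, hyc, hr'⟩ := h
    refine le_trans ?_ (coe_sub_le_conj (conj_le_coe_iff.2 hyc))
    rw [EReal.coe_le_coe_iff, real_inner_comm]
    exact hr'
  rcases hs0.eq_or_lt with hs0 | hs0
  -- Vertical hyperplane: `u - ⟨w, ·⟩` is negative on `dom f` and positive at `x`. Adding `t` times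
  -- it to a known affine minorant preserves minorization and lifts the value at `x` to at least
  -- `r`.
  · simp only [← hs0, zero_mul, add_zero] at hu' hψ
    have hd : 0 < u - inner ℝ w x := by linarith
    set t : ℝ := |r - (inner ℝ y₀ x - c₀)| / (u - inner ℝ w x) with ht
    have ht0 : 0 ≤ t := div_nonneg (abs_nonneg _) hd.le
    refine ⟨y₀ - t • w, c₀ - t * u, fun z a hz => ?_, ?_⟩
    · have h1 := mul_le_mul_of_nonneg_left (hu' z a hz).le ht0
      have h2 := h₀' z a hz
      rw [inner_sub_left, real_inner_smul_left]
      linarith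
    · have h1 : t * (u - inner ℝ w x) = |r - (inner ℝ y₀ x - c₀)| := div_mul_cancel₀ _ hd.ne'
      have h2 := le_abs_self (r - (inner ℝ y₀ x - c₀))
      rw [inner_sub_left, real_inner_smul_left]
      linarith
  · refine ⟨-(s⁻¹ • w), -(s⁻¹ * u), fun z a hz => ?_, ?_⟩
    · have h1 := mul_le_mul_of_nonneg_left (hu' z a hz).le (inv_pos.2 hs0).le
      rw [mul_add, inv_mul_cancel_left₀ hs0.ne'] at h1
      rw [inner_neg_left, real_inner_smul_left]
      linarith
    · have h1 := mul_le_mul_of_nonneg_left hψ.le (inv_pos.2 hs0).le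
      rw [mul_add, inv_mul_cancel_left₀ hs0.ne'] at h1
      rw [inner_neg_left, real_inner_smul_left]
      linarith

theorem le_conj_conj {f : E → EReal} (hf : f ∈ Gam0 E) (x : E) : f x ≤ conj (conj f) x :=
  (le_cl_of_le hf.2 (fun _ => le_rfl) x).trans (cl_le_conj_conj hf.1 x)

end Functions

/-! ### Composition and the `K`-epigraph. -/

section Basic

variable {E₁ E₂ : Type*}

theorem mem_domMap_iff {F : E₁ → WithTop E₂} {x : E₁} : x ∈ domMap F ↔ ∃ y : E₂, F x = y :=
  WithTop.ne_top_iff_exists.trans (exists_congr fun _ => eq_comm)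

theorem comp_of_eq_coe (g : E₂ → EReal) {F : E₁ → WithTop E₂} {x : E₁} {y : E₂} (h : F x = y) :
    comp g F x = g y := by
  simp only [comp, h]; rfl

theorem comp_of_eq_top (g : E₂ → EReal) {F : E₁ → WithTop E₂} {x : E₁} (h : F x = ⊤) :
    comp g F x = ⊤ := by
  simp only [comp, h]; rfl

theorem mem_coneEpi_iff [NormedAddCommGroup E₂] {K : Set E₂} {F : E₁ → WithTop E₂} {x : E₁} {y : E₂} :
    (x, y) ∈ coneEpi K F ↔ ∃ a : E₂, F x = a ∧ y - a ∈ K :=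
  ⟨fun h => h y rfl, fun h b hb => by rwa [← WithTop.coe_injective hb]⟩

theorem comp_le_coe_iff {g : E₂ → EReal} {F : E₁ → WithTop E₂} {x : E₁} {a : ℝ} :
    comp g F x ≤ a ↔ ∃ y : E₂, F x = y ∧ g y ≤ a := by
  constructor
  · intro h
    by_cases hx : F x = ⊤
    · simp [comp_of_eq_top g hx] at h
    · obtain ⟨y, hy⟩ := mem_domMap_iff.1 hx
      exact ⟨y, hy, by rwa [comp_of_eq_coe g hy] at h⟩
  · rintro ⟨y, hy, h⟩
    rwa [comp_of_eq_coe g hy]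

variable [NormedAddCommGroup E₂] [InnerProductSpace ℝ E₂]

theorem scal_of_eq_coe (v : E₂) {F : E₁ → WithTop E₂} {x : E₁} {y : E₂} (h : F x = y) :
    scal v F x = (inner ℝ v y : ℝ) := comp_of_eq_coe _ h

theorem add_mem_coneEpi {K : PointedCone ℝ E₂} {F : E₁ → WithTop E₂} {x : E₁} {y k : E₂}
    (h : (x, y) ∈ coneEpi (K : Set E₂) F) (hk : k ∈ K) : (x, y + k) ∈ coneEpi (K : Set E₂) F := by
  obtain ⟨a, ha, hay⟩ := mem_coneEpi_iff.1 h
  refine mem_coneEpi_iff.2 ⟨a, ha, ?_⟩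
  rw [add_sub_right_comm]
  exact K.add_mem hay hk

theorem mem_coneEpi_of_eq_coe {K : PointedCone ℝ E₂} {F : E₁ → WithTop E₂} {x : E₁} {y : E₂}
    (h : F x = y) : (x, y) ∈ coneEpi (K : Set E₂) F :=
  mem_coneEpi_iff.2 ⟨y, h, by rw [sub_self]; exact K.zero_mem⟩

theorem dom_scal_nonempty {F : E₁ → WithTop E₂} (hF : (domMap F).Nonempty) (v : E₂) :
    (dom (scal v F)).Nonempty := by
  obtain ⟨x, hx⟩ := hF
  obtain ⟨y, hy⟩ := mem_domMap_iff.1 hx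
  exact ⟨x, by simp only [dom, Set.mem_ofPred_eq, scal_of_eq_coe v hy, EReal.coe_lt_top]⟩

end Basic

/-! ### Weak duality and convexity of `η`. -/

section Composite

variable {E₁ E₂ : Type*} [NormedAddCommGroup E₁] [InnerProductSpace ℝ E₁]
  [NormedAddCommGroup E₂] [InnerProductSpace ℝ E₂]

theorem conj_scal_le_coe_iff {v : E₂} {F : E₁ → WithTop E₂} {p : E₁} {c : ℝ} :
    conj (scal v F) p ≤ c ↔ ∀ (x : E₁) (y : E₂), F x = y → inner ℝ p x - c ≤ inner ℝ v y := by
  rw [conj_le_coe_iff]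
  constructor
  · intro h x y hxy
    exact h x _ (scal_of_eq_coe v hxy).le
  · intro h x a ha
    obtain ⟨y, hy, hya⟩ := comp_le_coe_iff.1 ha
    exact (h x y hy).trans (EReal.coe_le_coe_iff.1 hya)

theorem mem_neg_polar_iff {K : Set E₂} {v : E₂} : v ∈ -polar K ↔ ∀ k ∈ K, 0 ≤ inner ℝ v k := by
  simp [polar, inner_neg_left]

/-- A sum defining `eta` that is not `+∞` has real summands. -/
theorem exists_coe_of_add_lt_top {g : E₂ → EReal} (hg : (dom g).Nonempty) {F : E₁ → WithTop E₂}
    (hF : (domMap F).Nonempty) {v : E₂} {p : E₁} (h : conj g v + conj (scal v F) p < ⊤) :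
    ∃ c d : ℝ, conj g v = c ∧ conj (scal v F) p = d := by
  -- In `EReal`, `⊤ + ⊥ = ⊥`, so a sum below `⊤` has summands below `⊤` only once `⊥` is excluded.
  have h1 := conj_ne_bot hg v
  have h2 := conj_ne_bot (dom_scal_nonempty hF v) p
  have h3 : conj g v ≠ ⊤ := fun h' => by rw [h', EReal.top_add_of_ne_bot h2] at h; exact h.false
  have h4 : conj (scal v F) p ≠ ⊤ := fun h' => by
    rw [h', EReal.add_top_of_ne_bot h1] at h; exact h.false
  exact ⟨_, _, (EReal.coe_toReal h3 h1).symm, (EReal.coe_toReal h4 h2).symm⟩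

theorem conj_comp_le_add {g : E₂ → EReal} (hg : (dom g).Nonempty) {F : E₁ → WithTop E₂}
    (hF : (domMap F).Nonempty) (v : E₂) (p : E₁) :
    conj (comp g F) p ≤ conj g v + conj (scal v F) p := by
  rcases eq_or_ne (conj g v + conj (scal v F) p) ⊤ with h | h
  · rw [h]; exact le_top
  obtain ⟨c, d, hc, hd⟩ := exists_coe_of_add_lt_top hg hF h.lt_top
  rw [hc, hd, ← EReal.coe_add]
  refine conj_le_coe_iff.2 fun x a ha => ?_
  obtain ⟨y, hy, hya⟩ := comp_le_coe_iff.1 ha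
  have h1 := conj_le_coe_iff.1 hc.le y a hya
  have h2 := conj_scal_le_coe_iff.1 hd.le x y hy
  linarith

theorem conj_comp_le_eta (K : Set E₂) {g : E₂ → EReal} (hg : (dom g).Nonempty)
    {F : E₁ → WithTop E₂} (hF : (domMap F).Nonempty) (p : E₁) :
    conj (comp g F) p ≤ eta K g F p :=
  le_iInf₂ fun v _ => conj_comp_le_add hg hF v p

theorem eta_le {K : Set E₂} {g : E₂ → EReal} {F : E₁ → WithTop E₂} {v : E₂} (hv : v ∈ -polar K)
    (p : E₁) : eta K g F p ≤ conj g v + conj (scal v F) p := iInf₂_le v hv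

/-- `η` is the partial infimum over the convex cone `-K°` of a function jointly convex in `(v, p)`.
Since the infimum need not be attained, near-minimizers are combined. -/
theorem isConvexFun_eta (K : Set E₂) {g : E₂ → EReal} (hg : (dom g).Nonempty)
    {F : E₁ → WithTop E₂} (hF : (domMap F).Nonempty) : IsConvexFun (eta K g F) := by
  rintro ⟨p, r⟩ hp ⟨q, s⟩ hq a b ha hb hab
  change eta K g F p ≤ r at hp
  change eta K g F q ≤ s at hq
  change eta K g F (a • p + b • q) ≤ ((a * r + b * s : ℝ) : EReal)
  have key : ∀ (p : E₁) (r r' : ℝ), eta K g F p ≤ r → r < r' → ∃ v ∈ -polar K, ∃ c d : ℝ,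
      conj g v = c ∧ conj (scal v F) p = d ∧ c + d < r' := by
    intro p r r' h hr
    obtain ⟨v, hv⟩ := iInf_lt_iff.1 (h.trans_lt (EReal.coe_lt_coe_iff.2 hr))
    obtain ⟨hvK, hv⟩ := iInf_lt_iff.1 hv
    obtain ⟨c, d, hc, hd⟩ := exists_coe_of_add_lt_top hg hF (hv.trans (EReal.coe_lt_top _))
    rw [hc, hd, ← EReal.coe_add, EReal.coe_lt_coe_iff] at hv
    exact ⟨v, hvK, c, d, hc, hd, hv⟩
  refine EReal.le_of_forall_lt_iff_le.1 fun z hz => ?_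
  rw [EReal.coe_lt_coe_iff] at hz
  set ε := z - (a * r + b * s) with hε
  obtain ⟨v, hv, c, d, hc, hd, hcd⟩ := key p r (r + ε) hp (by linarith)
  obtain ⟨v', hv', c', d', hc', hd', hcd'⟩ := key q s (s + ε) hq (by linarith)
  have hV : a • v + b • v' ∈ -polar K := by
    rw [mem_neg_polar_iff] at hv hv' ⊢
    intro k hk
    rw [inner_add_left, real_inner_smul_left, real_inner_smul_left]
    exact add_nonneg (mul_nonneg ha (hv k hk)) (mul_nonneg hb (hv' k hk))
  have hC : conj g (a • v + b • v') ≤ ((a * c + b * c' : ℝ) : EReal) :=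
    isConvexFun_conj g (x := (v, c)) hc.le (y := (v', c')) hc'.le ha hb hab
  have hD : conj (scal (a • v + b • v') F) (a • p + b • q) ≤ ((a * d + b * d' : ℝ) : EReal) := by
    refine conj_scal_le_coe_iff.2 fun x y hxy => ?_
    have h1 := mul_le_mul_of_nonneg_left (conj_scal_le_coe_iff.1 hd.le x y hxy) ha
    have h2 := mul_le_mul_of_nonneg_left (conj_scal_le_coe_iff.1 hd'.le x y hxy) hb
    simp only [inner_add_left, real_inner_smul_left]
    linarith
  refine (eta_le hV _).trans ((add_le_add hC hD).trans ?_)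
  rw [← EReal.coe_add, EReal.coe_le_coe_iff]
  have h1 := mul_le_mul_of_nonneg_left hcd.le ha
  have h2 := mul_le_mul_of_nonneg_left hcd'.le hb
  have h3 : a * ε + b * ε = ε := by rw [← add_mul, hab, one_mul]
  linarith

/-- A convex combination of values of `F` lies over the same combination of arguments in the
`K`-epigraph, where `hmono` bounds `g ∘ F` by `g`. -/
theorem comp_mem_gam {K : Set E₂} {F : E₁ → WithTop E₂} (hFconvex : IsConeConvex K F)
    (hK : 0 ∈ K) {g : E₂ → EReal} (hg : g ∈ Gam E₂)
    (hmono : ∀ (x : E₁) (y : E₂), (x, y) ∈ coneEpi K F → comp g F x ≤ g y)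
    (hne : (dom (comp g F)).Nonempty) : comp g F ∈ Gam E₁ := by
  refine ⟨⟨hne, fun x hx => ?_⟩, ?_⟩
  · by_cases h : F x = ⊤
    · simp [comp_of_eq_top g h] at hx
    · obtain ⟨y, hy⟩ := mem_domMap_iff.1 h
      exact hg.1.2 y (by rwa [comp_of_eq_coe g hy] at hx)
  · rintro ⟨x, r⟩ hx ⟨x', r'⟩ hx' a b ha hb hab
    obtain ⟨y, hy, hyr⟩ := comp_le_coe_iff.1 hx
    obtain ⟨y', hy', hyr'⟩ := comp_le_coe_iff.1 hx'
    have h1 : (x, y) ∈ coneEpi K F := mem_coneEpi_iff.2 ⟨y, hy, by simpa using hK⟩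
    have h2 : (x', y') ∈ coneEpi K F := mem_coneEpi_iff.2 ⟨y', hy', by simpa using hK⟩
    exact (hmono _ _ (hFconvex h1 h2 ha hb hab)).trans
      (hg.2 (x := (y, r)) hyr (y := (y', r')) hyr' ha hb hab)

/-- Along the ray `y - t • k` the function `g` stays below `g y`; if `⟨v, k⟩ < 0`, then `⟨v, ·⟩ - g`
would be unbounded above there. -/
theorem mem_neg_polar_of_conj_le {K : PointedCone ℝ E₂} {g : E₂ → EReal} (hg : (dom g).Nonempty)
    (hinc : IsIncreasing (K : Set E₂) g) {v : E₂} {c : ℝ} (hv : conj g v ≤ c) :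
    v ∈ -polar (K : Set E₂) := by
  rw [mem_neg_polar_iff]
  intro k hk
  by_contra! hneg
  obtain ⟨y, hy⟩ := hg
  obtain ⟨a, ha⟩ := exists_le_coe hy
  have key : ∀ t : ℝ, 0 ≤ t → inner ℝ v y - t * inner ℝ v k - c ≤ a := by
    intro t ht
    have h1 : g (y - t • k) ≤ g y := hinc _ _ fun b hb => by
      rw [← WithTop.coe_injective hb]
      refine ⟨_, rfl, ?_⟩
      rw [sub_sub_cancel]
      exact K.smul_mem ht hk
    have h2 := conj_le_coe_iff.1 hv _ _ (h1.trans ha)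
    rwa [inner_sub_right, real_inner_smul_right] at h2
  set b := |a + c - inner ℝ v y| + 1 with hb
  have h1 := key (b / (-inner ℝ v k)) (div_nonneg (by positivity) (by linarith))
  have h2 : b / (-inner ℝ v k) * inner ℝ v k = -b := by
    rw [div_neg, neg_mul, div_mul_cancel₀ _ hneg.ne]
  have h3 := le_abs_self (a + c - inner ℝ v y)
  linarith

end Composite

/-! ### Biconjugation and strong duality. -/

section Duality

variable {E₁ E₂ : Type*} [NormedAddCommGroup E₁] [InnerProductSpace ℝ E₁]
  [NormedAddCommGroup E₂] [InnerProductSpace ℝ E₂] [FiniteDimensional ℝ E₂]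

theorem cl_eta_le_conj_comp [FiniteDimensional ℝ E₁] {K : PointedCone ℝ E₂} {F : E₁ → WithTop E₂}
    {g : E₂ → EReal} (hF : ∀ v ∈ -polar (K : Set E₂), scal v F ∈ Gam0 E₁) (hg : g ∈ Gam0 E₂)
    (hinc : IsIncreasing (K : Set E₂) g) (hne : (rge F ∩ dom g).Nonempty) (p : E₁) :
    cl (eta (K : Set E₂) g F) p ≤ conj (comp g F) p := by
  obtain ⟨y₀, ⟨x₀, hx₀⟩, hy₀⟩ := hne
  have hFdom : (domMap F).Nonempty := ⟨x₀, mem_domMap_iff.2 ⟨y₀, hx₀⟩⟩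
  have hgne : (dom g).Nonempty := ⟨y₀, hy₀⟩
  -- This is `g ∘ F ≤ η*` in terms of real bounds.
  have key : ∀ (x : E₁) (r : ℝ), (r : EReal) < comp g F x →
      ∃ (q : E₁) (s : ℝ), eta (K : Set E₂) g F q ≤ s ∧ r ≤ inner ℝ x q - s := by
    intro x r hr
    obtain ⟨v, c, hv, hc⟩ : ∃ (v : E₂) (c : ℝ), conj g v ≤ c ∧
        ((r + c : ℝ) : EReal) < scal v F x := by
      by_cases hx : F x = ⊤
      · obtain ⟨v, c, hv⟩ := exists_conj_le hg.1
        exact ⟨v, c, hv, by rw [scal, comp_of_eq_top _ hx]; exact EReal.coe_lt_top _⟩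
      · obtain ⟨y, hy⟩ := mem_domMap_iff.1 hx
        rw [comp_of_eq_coe g hy] at hr
        have h1 : ¬ conj (conj g) y ≤ r := (hr.trans_le (le_conj_conj hg y)).not_ge
        rw [conj_le_coe_iff] at h1
        push Not at h1
        obtain ⟨v, c, hv, hc⟩ := h1
        refine ⟨v, c, hv, ?_⟩
        rw [scal_of_eq_coe v hy, EReal.coe_lt_coe_iff, real_inner_comm]
        linarith
    have hvK := mem_neg_polar_of_conj_le hgne hinc hv
    have h1 : ¬ conj (conj (scal v F)) x ≤ ((r + c : ℝ) : EReal) :=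
      (hc.trans_le (le_conj_conj (hF v hvK) x)).not_ge
    rw [conj_le_coe_iff] at h1
    push Not at h1
    obtain ⟨q, d, hq, hd⟩ := h1
    refine ⟨q, c + d, (eta_le hvK q).trans ?_, by linarith⟩
    rw [EReal.coe_add]
    exact add_le_add hv hq
  have hη : eta (K : Set E₂) g F ∈ Gam E₁ := by
    refine ⟨⟨?_, fun q => ?_⟩, isConvexFun_eta _ hgne hFdom⟩
    · obtain ⟨r, -, hr⟩ := EReal.lt_iff_exists_real_btwn.1 (bot_lt_iff_ne_bot.2 (hg.1.1.2 y₀))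
      obtain ⟨q, s, hq, -⟩ := key x₀ r (by rwa [comp_of_eq_coe g hx₀])
      exact ⟨q, hq.trans_lt (EReal.coe_lt_top _)⟩
    · refine ne_bot_of_le_ne_bot (conj_ne_bot ⟨x₀, ?_⟩ q) (conj_comp_le_eta _ hgne hFdom q)
      simpa only [dom, Set.mem_ofPred_eq, comp_of_eq_coe g hx₀] using hy₀
  refine (cl_le_conj_conj hη p).trans (conj_antitone (fun x => ?_) p)
  refine EReal.ge_of_forall_gt_iff_ge.1 fun r hr => ?_
  obtain ⟨q, s, hq, hs⟩ := key x r hr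
  exact (EReal.coe_le_coe_iff.2 hs).trans (coe_sub_le_conj hq)

/-- Prolonging the segment from `k` beyond `k₀` gives `(1 + c) • k₀ - c • k ∈ K`; divide by `c`. -/
theorem exists_smul_sub_mem_of_mem_intrinsicInterior {V : Type*} [NormedAddCommGroup V]
    [NormedSpace ℝ V] {K : PointedCone ℝ V} {k₀ k : V}
    (hk₀ : k₀ ∈ intrinsicInterior ℝ (K : Set V)) (hk : k ∈ K) : ∃ m : ℝ, 0 ≤ m ∧ m • k₀ - k ∈ K := by
  obtain ⟨c, hc, h⟩ := exists_prolong_of_mem_intrinsicInterior hk₀ hk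
  refine ⟨c⁻¹ * (1 + c), by positivity, ?_⟩
  have := K.smul_mem (inv_pos.2 hc).le h
  convert this using 1
  have h1 : k = c⁻¹ • c • k := (inv_smul_smul₀ hc.ne' k).symm
  conv_lhs => rw [h1]
  module

/-- Under the constraint qualification, `0` is a relative algebraic interior point of the set of
differences of points of `F (dom F) + K` and of `dom g`. -/
theorem exists_neg_smul_sub_eq {K : PointedCone ℝ E₂} {F : E₁ → WithTop E₂}
    (hFconvex : IsConeConvex (K : Set E₂) F) {g : E₂ → EReal} (hg : IsConvexFun g)
    {x₀ : E₁} {y₀ : E₂} (hx₀ : x₀ ∈ intrinsicInterior ℝ (domMap F)) (hxy₀ : F x₀ = y₀)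
    (hy₀ : y₀ ∈ intrinsicInterior ℝ (dom g - (K : Set E₂)))
    {x₁ : E₁} {y₁ d₁ : E₂} (h₁ : (x₁, y₁) ∈ coneEpi (K : Set E₂) F) (hd₁ : d₁ ∈ dom g) :
    ∃ δ : ℝ, 0 < δ ∧ ∃ (x : E₁) (y d : E₂), (x, y) ∈ coneEpi (K : Set E₂) F ∧ d ∈ dom g ∧
      y - d = -(δ • (y₁ - d₁)) := by
  obtain ⟨ε, hε, hx⟩ := exists_prolong_of_mem_intrinsicInterior hx₀
    (show x₁ ∈ domMap F by
      obtain ⟨a, ha, -⟩ := mem_coneEpi_iff.1 h₁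
      exact mem_domMap_iff.2 ⟨a, ha⟩)
  obtain ⟨y', hy'⟩ := mem_domMap_iff.1 hx
  set x' := x₀ - ε • (x₁ - x₀) with hx'
  obtain ⟨k₀, hk₀⟩ := Set.Nonempty.intrinsicInterior (K.toConvexCone.convex) ⟨0, K.zero_mem⟩
  have hε1 : 0 < 1 + ε := by linarith
  have e₀ := mem_coneEpi_of_eq_coe (K := K) hxy₀
  -- the convexity gap of `F` along the prolonged segment
  have hk : y' + ε • y₁ - (1 + ε) • y₀ ∈ K := by
    have h2 := hFconvex (mem_coneEpi_of_eq_coe (K := K) hy') h₁ (inv_pos.2 hε1).le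
      (mul_pos (inv_pos.2 hε1) hε).le (by field_simp)
    simp only [Prod.smul_mk, Prod.mk_add_mk] at h2
    have h3 : (1 + ε)⁻¹ • x' + ((1 + ε)⁻¹ * ε) • x₁ = x₀ := by
      have : x₀ = (1 + ε)⁻¹ • (1 + ε) • x₀ := (inv_smul_smul₀ hε1.ne' _).symm
      conv_rhs => rw [this]
      rw [hx']
      module
    rw [h3] at h2
    obtain ⟨a, ha, hak⟩ := mem_coneEpi_iff.1 h2
    obtain rfl : y₀ = a := WithTop.coe_injective (hxy₀.symm.trans ha)
    have h4 := K.smul_mem hε1.le hak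
    convert h4 using 1
    rw [smul_sub, smul_add, smul_smul, smul_smul, ← mul_assoc, mul_inv_cancel₀ hε1.ne']
    simp
  obtain ⟨m, hm0, hm⟩ := exists_smul_sub_mem_of_mem_intrinsicInterior hk₀ hk
  have e₁ : (x', y₀ + m • k₀ - ε • (y₁ - y₀)) ∈ coneEpi (K : Set E₂) F := by
    refine mem_coneEpi_iff.2 ⟨y', hy', ?_⟩
    change y₀ + m • k₀ - ε • (y₁ - y₀) - y' ∈ K
    convert hm using 1
    module
  have hC : Convex ℝ (dom g - (K : Set E₂)) := (convex_dom hg).sub K.toConvexCone.convex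
  -- The shift `(m / ε) • k₀` is chosen so that, in the weighted averages `e₂` and `h₃` below, the
  -- `k₀` terms cancel on subtraction.
  have hmem : d₁ - (m / ε) • k₀ ∈ dom g - (K : Set E₂) :=
    Set.sub_mem_sub hd₁ (K.smul_mem (div_nonneg hm0 hε.le) (intrinsicInterior_subset hk₀))
  obtain ⟨c, hc, h₂⟩ := exists_prolong_of_mem_intrinsicInterior hy₀ hmem
  have hcε : 0 < c + ε := add_pos hc hε
  have hsum : ε / (c + ε) + c / (c + ε) = 1 := by rw [← add_div, add_comm, div_self hcε.ne']
  have e₂ := hFconvex e₀ e₁ (div_pos hε hcε).le (div_pos hc hcε).le hsum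
  simp only [Prod.smul_mk, Prod.mk_add_mk] at e₂
  have h₃ := hC (intrinsicInterior_subset hy₀) h₂ (div_pos hc hcε).le (div_pos hε hcε).le
    (by rw [add_comm, hsum])
  obtain ⟨d, hd, k, hk', hdk⟩ := h₃
  refine ⟨c * ε / (c + ε), by positivity, _, _, d, add_mem_coneEpi e₂ hk', hd, ?_⟩
  have hd' : d = k + _ := sub_eq_iff_eq_add'.1 hdk
  rw [hd']
  match_scalars <;> field_simp <;> ring

/-- Under the constraint qualification, the dual infimum is attained. -/
theorem exists_add_le_of_conj_comp_le {K : PointedCone ℝ E₂} {F : E₁ → WithTop E₂}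
    (hFconvex : IsConeConvex (K : Set E₂) F) {g : E₂ → EReal} (hg : g ∈ Gam E₂)
    (hmono : ∀ (x : E₁) (y : E₂), (x, y) ∈ coneEpi (K : Set E₂) F → comp g F x ≤ g y)
    {x₀ : E₁} {y₀ : E₂} (hx₀ : x₀ ∈ intrinsicInterior ℝ (domMap F)) (hxy₀ : F x₀ = y₀)
    (hy₀ : y₀ ∈ intrinsicInterior ℝ (dom g - (K : Set E₂)))
    {p : E₁} {μ : ℝ} (hμ : conj (comp g F) p ≤ μ) :
    ∃ v ∈ -polar (K : Set E₂), conj g v + conj (scal v F) p ≤ μ := by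
  obtain ⟨d₀, hd₀⟩ := hg.1.1
  obtain ⟨a₀, ha₀⟩ := exists_le_coe hd₀
  have e₀ := mem_coneEpi_of_eq_coe (K := K) hxy₀
  rw [conj_le_coe_iff] at hμ
  let S : Set (E₂ × ℝ) := {q | ∃ (x : E₁) (y d : E₂) (a : ℝ), (x, y) ∈ coneEpi (K : Set E₂) F ∧
    g d ≤ a ∧ q = (y - d, a - inner ℝ p x + μ)}
  have hS : Convex ℝ S := by
    rintro _ ⟨x, y, d, a, hxy, hd, rfl⟩ _ ⟨x', y', d', a', hxy', hd', rfl⟩ s t hs ht hst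
    refine ⟨_, _, _, _, hFconvex hxy hxy' hs ht hst,
      hg.2 (x := (d, a)) hd (y := (d', a')) hd' hs ht hst, ?_⟩
    simp only [Prod.smul_mk, Prod.mk_add_mk, inner_add_right, real_inner_smul_right, smul_eq_mul,
      Prod.mk.injEq]
    refine ⟨by module, ?_⟩
    have : s * μ + t * μ = μ := by rw [← add_mul, hst, one_mul]
    linarith
  obtain ⟨l, hl⟩ := exists_linear_le hS ⟨_, x₀, y₀, d₀, a₀, e₀, ha₀, rfl⟩
    (by
      rintro r ⟨x, y, d, a, hxy, hd, h⟩
      rw [Prod.mk.injEq] at h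
      obtain rfl : y = d := sub_eq_zero.1 h.1.symm
      have := hμ x a ((hmono x y hxy).trans hd)
      linarith)
    (by
      rintro _ ⟨x, y, d, a, hxy, hd, rfl⟩
      obtain ⟨δ, hδ, x', y', d', hxy', hd', h⟩ := exists_neg_smul_sub_eq hFconvex hg.2 hx₀ hxy₀ hy₀
        hxy (show d ∈ dom g from hd.trans_lt (EReal.coe_lt_top a))
      obtain ⟨a', ha'⟩ := exists_le_coe hd'
      exact ⟨δ, hδ, _, x', y', d', a', hxy', ha', by rw [h]⟩)
  obtain ⟨w, hw⟩ := exists_inner_eq l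
  have key : ∀ (x : E₁) (y d : E₂) (a : ℝ), (x, y) ∈ coneEpi (K : Set E₂) F → g d ≤ a →
      inner ℝ (-w) d - (μ - inner ℝ p x + inner ℝ (-w) y) ≤ a := by
    intro x y d a hxy hd
    have := hl _ ⟨x, y, d, a, hxy, hd, rfl⟩
    simp only [hw, inner_sub_right] at this
    rw [inner_neg_left, inner_neg_left]
    linarith
  have hle : ∀ (x : E₁) (y : E₂), F x = y →
      conj g (-w) ≤ ((μ - inner ℝ p x + inner ℝ (-w) y : ℝ) : EReal) := fun x y hxy =>
    conj_le_coe_iff.2 fun d a hd => key x y d a (mem_coneEpi_of_eq_coe hxy) hd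
  refine ⟨-w, mem_neg_polar_iff.2 fun k hk => ?_, ?_⟩
  -- Raising `y₀` by a large multiple of `k` stays in the `K`-epigraph and would violate `key`.
  · by_contra! hneg
    set B := inner ℝ (-w) d₀ - (μ - inner ℝ p x₀ + inner ℝ (-w) y₀) - a₀ with hB
    have h1 := key x₀ _ d₀ a₀ (add_mem_coneEpi e₀ (K.smul_mem
      (div_nonneg (by positivity : (0 : ℝ) ≤ |B| + 1) (by linarith :
        (0 : ℝ) ≤ -inner ℝ (-w) k)) hk)) ha₀
    rw [inner_add_right, real_inner_smul_right, div_neg, neg_mul, div_mul_cancel₀ _ hneg.ne] at h1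
    have h2 := neg_abs_le B
    linarith
  -- `hle` is the supremum over `d`; with `g*(-w) = c` finite, rearranging it bounds the supremum
  -- over `x`.
  · obtain ⟨c, hc⟩ := exists_coe_eq_conj ⟨d₀, hd₀⟩ ((hle x₀ y₀ hxy₀).trans_lt (EReal.coe_lt_top _))
    have h1 : conj (scal (-w) F) p ≤ ((μ - c : ℝ) : EReal) := by
      refine conj_scal_le_coe_iff.2 fun x y hxy => ?_
      have := hle x y hxy
      rw [hc, EReal.coe_le_coe_iff] at this
      linarith
    rw [hc]
    refine (add_le_add le_rfl h1).trans ?_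
    rw [← EReal.coe_add, add_sub_cancel]

end Duality
end ConvexComposite

open ConvexComposite in
/-- Conjugate of a composite function. A closed convex cone is a `PointedCone` (in Mathlib: a convex
cone containing `0`, possibly containing lines) that is closed; `intrinsicInterior ℝ` is the
relative interior. -/
theorem mainTheorem1 {E₁ E₂ : Type*}
    [NormedAddCommGroup E₁] [InnerProductSpace ℝ E₁] [FiniteDimensional ℝ E₁]
    [NormedAddCommGroup E₂] [InnerProductSpace ℝ E₂] [FiniteDimensional ℝ E₂]
    (K : PointedCone ℝ E₂) (hK : IsClosed (K : Set E₂))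
    (F : E₁ → WithTop E₂) (hFproper : (domMap F).Nonempty)
    (hFconvex : IsConeConvex (K : Set E₂) F)
    (g : E₂ → EReal) (hg : g ∈ Gam E₂)
    (hmono : ∀ (x : E₁) (y : E₂), (x, y) ∈ coneEpi (K : Set E₂) F → comp g F x ≤ g y) :
    -- a)
    (∀ p : E₁, conj (comp g F) p ≤ cl (eta (K : Set E₂) g F) p) ∧
    ((∀ v ∈ -polar (K : Set E₂), scal v F ∈ Gam0 E₁) → LowerSemicontinuous g →
      IsIncreasing (K : Set E₂) g → (rge F ∩ dom g).Nonempty →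
      ∀ p : E₁, conj (comp g F) p = cl (eta (K : Set E₂) g F) p) ∧
    ((F '' intrinsicInterior ℝ (domMap F) ∩
        (fun y : E₂ => (y : WithTop E₂)) '' intrinsicInterior ℝ (dom g - (K : Set E₂))).Nonempty →
      -- b)
      (LowerSemicontinuous (eta (K : Set E₂) g F) ∧ IsProperFun (eta (K : Set E₂) g F) ∧
        IsConvexFun (eta (K : Set E₂) g F) ∧
        ∀ p : E₁, ∃ v ∈ -polar (K : Set E₂),
          conj g v + conj (scal v F) p = eta (K : Set E₂) g F p) ∧
      -- c)
      (∀ p : E₁, IsLeast ((fun v => conj g v + conj (scal v F) p) '' (-polar (K : Set E₂)))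
        (conj (comp g F) p)) ∧
      dom (conj (comp g F)) =
        {p : E₁ | ∃ v ∈ dom (conj g) ∩ -polar (K : Set E₂), conj (scal v F) p < ⊤}) := by
  have hgne := hg.1.1
  refine ⟨fun p => le_cl_of_le (lowerSemicontinuous_conj _)
      (conj_comp_le_eta _ hgne hFproper) p, fun hF hlsc hinc hne p =>
      le_antisymm (le_cl_of_le (lowerSemicontinuous_conj _) (conj_comp_le_eta _ hgne hFproper) p)
        (cl_eta_le_conj_comp hF ⟨hg, hlsc⟩ hinc hne p), ?_⟩
  rintro ⟨_, ⟨x₀, hx₀, rfl⟩, y₀, hy₀, hxy₀⟩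
  have hdom : (dom (comp g F)).Nonempty := by
    obtain ⟨d, hd, k, hk, hdk⟩ := intrinsicInterior_subset hy₀
    refine ⟨x₀, (hmono x₀ d (mem_coneEpi_iff.2 ⟨y₀, hxy₀.symm, ?_⟩)).trans_lt hd⟩
    rw [← hdk]
    simpa using hk
  have hcomp : comp g F ∈ Gam E₁ := comp_mem_gam hFconvex K.zero_mem hg hmono hdom
  have hatt : ∀ p : E₁, ∃ v ∈ -polar (K : Set E₂),
      conj g v + conj (scal v F) p = conj (comp g F) p := by
    intro p
    rcases eq_or_ne (conj (comp g F) p) ⊤ with htop | htop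
    -- When the conjugate is `⊤`, weak duality makes every sum `⊤`, so any `v` in `-K°` attains it.
    · refine ⟨0, mem_neg_polar_iff.2 fun k _ => by simp,
        le_antisymm (htop ▸ le_top) (conj_comp_le_add hgne hFproper 0 p)⟩
    · obtain ⟨μ, hμ⟩ := exists_coe_eq_conj hdom htop.lt_top
      obtain ⟨v, hv, hle⟩ :=
        exists_add_le_of_conj_comp_le hFconvex hg hmono hx₀ hxy₀.symm hy₀ hμ.le
      exact ⟨v, hv, le_antisymm (hμ ▸ hle) (conj_comp_le_add hgne hFproper v p)⟩
  have heta : eta (K : Set E₂) g F = conj (comp g F) := by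
    funext p
    obtain ⟨v, hv, h⟩ := hatt p
    exact le_antisymm (h ▸ eta_le hv p) (conj_comp_le_eta _ hgne hFproper p)
  refine ⟨?_, fun p => ?_, ?_⟩
  · rw [heta]
    exact ⟨lowerSemicontinuous_conj _, isProperFun_conj hcomp, isConvexFun_conj _, hatt⟩
  · obtain ⟨v, hv, h⟩ := hatt p
    refine ⟨⟨v, hv, h⟩, ?_⟩
    rintro _ ⟨w, -, rfl⟩
    exact conj_comp_le_add hgne hFproper w p
  · ext p
    constructor
    · intro hp
      obtain ⟨v, hv, h⟩ := hatt p
      obtain ⟨c, d, hc, hd⟩ := exists_coe_of_add_lt_top hgne hFproper (v := v) (p := p) (h ▸ hp)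
      exact ⟨v, ⟨hc.trans_lt (EReal.coe_lt_top c), hv⟩, hd.trans_lt (EReal.coe_lt_top d)⟩
    · rintro ⟨v, ⟨hv, -⟩, hp⟩
      exact (conj_comp_le_add hgne hFproper v p).trans_lt (EReal.add_lt_top hv.ne hp.ne)
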